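/- Let $Q=[0,1]^2$, and use the max norm $|(v_1,v_2)|=\max(|v_1|,|v_2|)$ on $\mathbb R^2$ (also for lengths of curves). Let $\{E_i\}$ be a countable family of closed curvilinear rectangles in $Q$ of full height: each is bounded below and above by subintervals of the sides $y=0$ and $y=1$ of $Q$, and on the left and right by disjoint continuous graphs $x=x(y)$, $0\le y\le1$. Let each $f_i$ be a $C^2$ diffeomorphism defined on an open neighbourhood of $E_i$ that maps $E_i$ onto a curvilinear strip $S_i=f_i(E_i)\subset Q$ of full width: $S_i$ is bounded on the left and right by subintervals of the sides $x=0$ and $x=1$ of $Q$, and below and above by disjoint continuous graphs $y=y(x)$, $0\le x\le1$; $f_i$ takes the pair of left and right sides of $E_i$ onto the pair of left and right sides of $S_i$, and the pair of bottom and top sides onto the pair of bottom and top sides. For $z\in Q$ let $\delta_z(E_i)$ be the diameter of the section of $E_i$ by the horizontal line through $z$, and let $\delta_{i,\max}$, $\delta_{i,\min}$ be its maximum and minimum over $z\in Q$. Assume: - (geometric conditions) $\operatorname{int}E_i\cap\operatorname{int}E_j=\emptyset$ and $\operatorname{int}S_i\cap\operatorname{int}S_j=\emptyset$ for $i\ne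 j$; $Q\setminus\bigcup_i\operatorname{int}E_i$ has Lebesgue measure zero; $-\sum_i\delta_{i,\max}\log\delta_{i,\min}<\infty$; - (hyperbolicity conditions) there are constants $0<\alpha<1$ and $K_0>1$ with $\frac1{K_0^2}+\alpha^2<1$ such that for every $i$ the map $F=(F_1,F_2)=f_i$, with $J_F=|F_{1x}F_{2y}-F_{1y}F_{2x}|$, satisfies at every point of $E_i$ $$|F_{2x}|+\alpha|F_{2y}|+\alpha^2|F_{1y}|\le\alpha|F_{1x}|,\qquad |F_{1x}|-\alpha|F_{1y}|\ge K_0,$$ $$|F_{1y}|+\alpha|F_{2y}|+\alpha^2|F_{2x}|\le\alpha|F_{1x}|,\qquad |F_{1x}|-\alpha|F_{2x}|\ge J_FK_0;$$ - (distortion condition) there is a constant $C_0>0$ with $|D^2f_i(z)|/|f_{ix}(z)|<C_0$ for all $i$ and all $z\in E_i$, where $|D^2f_i(z)|$ is the maximum of the absolute values of the second partial derivatives of the two components of $f_i$ at $z$, and $f_{ix}$ is the partial derivative of $f_i$ in $x$. For a sequence of indices $\omega=(\dots,i_{-2},i_{-1})$ define $S_{i_{-1}}=f_{i_{-1}}(E_{i_{-1}})$,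 $S_{i_{-m}\dots i_{-1}}=f_{i_{-1}}(S_{i_{-m}\dots i_{-2}}\cap E_{i_{-1}})$ and $W_\omega=\bigcap_{k\ge1}S_{i_{-k}\dots i_{-1}}$. Let $\Lambda=\bigcup_\omega W_\omega$ be the topological attractor. For $z\in\Lambda$, an unstable manifold of $z$ is a set $W^u(z)=W_\omega$ containing $z$; put $W^u(z,E_i)=W^u(z)\cap E_i$, and let $|W^u(z,E_i)|$ be its length (one-dimensional Hausdorff measure). Then there is a constant $c$, independent of $i$, such that for every $i$, all $z_1,z_2\in E_i\cap\Lambda$ and any unstable manifolds $W^u(z_1)$, $W^u(z_2)$ of these points, the lengths $|W^u(z_1,E_i)|$ and $|W^u(z_2,E_i)|$ are positive and finite, and $$\frac{|W^u(z_1,E_i)|}{|W^u(z_2,E_i)|}<c .$$ -/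

import Mathlib

noncomputable section

namespace CountableMarkov

open Set

/-- The unit square `Q`. The plane is `ℝ × ℝ`, whose norm in Mathlib is the max norm
`|(v₁, v₂)| = max |v₁| |v₂|`. -/
def unitSquare : Set (ℝ × ℝ) := Icc 0 1 ×ˢ Icc 0 1

/-- A closed curvilinear rectangle in `Q` of full height: it is bounded below and above by
subintervals of the sides `y = 0` and `y = 1` of `Q`, and on the left and on the right by
continuous curves `x = left y`, `x = right y`. -/
structure FullHeightRect where
  left : ℝ → ℝ
  right : ℝ → ℝ
  continuousOn_left : ContinuousOn left (Icc 0 1)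
  continuousOn_right : ContinuousOn right (Icc 0 1)
  left_nonneg : ∀ y ∈ Icc (0 : ℝ) 1, 0 ≤ left y
  left_lt_right : ∀ y ∈ Icc (0 : ℝ) 1, left y < right y
  right_le_one : ∀ y ∈ Icc (0 : ℝ) 1, right y ≤ 1

namespace FullHeightRect

/-- The closed region. -/
def toSet (E : FullHeightRect) : Set (ℝ × ℝ) :=
  {z | z.2 ∈ Icc (0 : ℝ) 1 ∧ E.left z.2 ≤ z.1 ∧ z.1 ≤ E.right z.2}

/-- The union of the left and right sides. -/
def lateralSides (E : FullHeightRect) : Set (ℝ × ℝ) :=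
  {z | z.2 ∈ Icc (0 : ℝ) 1 ∧ (z.1 = E.left z.2 ∨ z.1 = E.right z.2)}

/-- The union of the bottom and top sides. -/
def horizontalSides (E : FullHeightRect) : Set (ℝ × ℝ) :=
  {z | z ∈ E.toSet ∧ (z.2 = 0 ∨ z.2 = 1)}

end FullHeightRect

/-- A closed curvilinear strip in `Q` of full width: it is bounded on the left and on the right by
subintervals of the sides `x = 0` and `x = 1` of `Q`, and below and above by continuous curves
`y = bottom x`, `y = top x`. -/
structure FullWidthStrip where
  bottom : ℝ → ℝ
  top : ℝ → ℝ
  continuousOn_bottom : ContinuousOn bottom (Icc 0 1)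
  continuousOn_top : ContinuousOn top (Icc 0 1)
  bottom_nonneg : ∀ x ∈ Icc (0 : ℝ) 1, 0 ≤ bottom x
  bottom_lt_top : ∀ x ∈ Icc (0 : ℝ) 1, bottom x < top x
  top_le_one : ∀ x ∈ Icc (0 : ℝ) 1, top x ≤ 1

namespace FullWidthStrip

/-- The closed region. -/
def toSet (S : FullWidthStrip) : Set (ℝ × ℝ) :=
  {z | z.1 ∈ Icc (0 : ℝ) 1 ∧ S.bottom z.1 ≤ z.2 ∧ z.2 ≤ S.top z.1}

/-- The union of the left and right sides. -/
def lateralSides (S : FullWidthStrip) : Set (ℝ × ℝ) :=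
  {z | z ∈ S.toSet ∧ (z.1 = 0 ∨ z.1 = 1)}

/-- The union of the bottom and top sides. -/
def horizontalSides (S : FullWidthStrip) : Set (ℝ × ℝ) :=
  {z | z.1 ∈ Icc (0 : ℝ) 1 ∧ (z.2 = S.bottom z.1 ∨ z.2 = S.top z.1)}

end FullWidthStrip

/-- The `C²` diffeomorphism `f`, defined on an open neighbourhood of the full height rectangle `E`,
maps `E` onto the full width strip `S`, as a map of curvilinear rectangles: the pair of lateral
sides goes onto the pair of lateral sides and the pair of horizontal sides onto the pair of
horizontal sides. Either pair of sides may be interchanged. -/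
structure MapsOnto (f : OpenPartialHomeomorph (ℝ × ℝ) (ℝ × ℝ))
    (E : FullHeightRect) (S : FullWidthStrip) : Prop where
  subset_source : E.toSet ⊆ f.source
  contDiffOn : ContDiffOn ℝ 2 f f.source
  contDiffOn_symm : ContDiffOn ℝ 2 f.symm f.target
  image_eq : f '' E.toSet = S.toSet
  image_lateralSides : f '' E.lateralSides = S.lateralSides
  image_horizontalSides : f '' E.horizontalSides = S.horizontalSides

/-- The piecewise smooth system: rectangles `E i` of full height, strips `S i` of full width and
diffeomorphisms `f i` mapping `E i` onto `S i`. -/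
structure Model (ι : Type*) where
  E : ι → FullHeightRect
  S : ι → FullWidthStrip
  f : ι → OpenPartialHomeomorph (ℝ × ℝ) (ℝ × ℝ)
  mapsOnto : ∀ i, MapsOnto (f i) (E i) (S i)

/-- `δ_z(E)`, the diameter of the section of `E` by the horizontal line through `z`. -/
def sectionWidth (E : Set (ℝ × ℝ)) (z : ℝ × ℝ) : ℝ := Metric.diam {w | w ∈ E ∧ w.2 = z.2}

/-- The largest width `max_{z ∈ Q} δ_z(E)`. -/
def maxWidth (E : Set (ℝ × ℝ)) : ℝ := sSup (sectionWidth E '' unitSquare)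

/-- The smallest width `min_{z ∈ Q} δ_z(E)`. -/
def minWidth (E : Set (ℝ × ℝ)) : ℝ := sInf (sectionWidth E '' unitSquare)

/-- Partial derivative in `x` (a vector with components `F₁ₓ`, `F₂ₓ`). -/
def partialX (F : ℝ × ℝ → ℝ × ℝ) (z : ℝ × ℝ) : ℝ × ℝ := fderiv ℝ F z (1, 0)

/-- Partial derivative in `y` (a vector with components `F₁ᵧ`, `F₂ᵧ`). -/
def partialY (F : ℝ × ℝ → ℝ × ℝ) (z : ℝ × ℝ) : ℝ × ℝ := fderiv ℝ F z (0, 1)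

/-- The absolute value of the Jacobian determinant. -/
def absJacobian (F : ℝ × ℝ → ℝ × ℝ) (z : ℝ × ℝ) : ℝ :=
  |(partialX F z).1 * (partialY F z).2 - (partialY F z).1 * (partialX F z).2|

/-- `|D²F(z)|`: the largest absolute value of the second partial derivatives `F_{jxx}`, `F_{jxy}`,
`F_{jyy}`, `j = 1, 2`. The maximum over `j` is the max norm of `ℝ × ℝ`. -/
def secondDerivSize (F : ℝ × ℝ → ℝ × ℝ) (z : ℝ × ℝ) : ℝ :=
  max ‖partialX (partialX F) z‖ (max ‖partialY (partialX F) z‖ ‖partialY (partialY F) z‖)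

namespace Model

variable {ι : Type*}

/-- The geometric conditions: disjoint interiors, full Lebesgue measure, and
`-∑ δ_{i,max} log δ_{i,min} < ∞` (a series with nonnegative terms). -/
structure GeometricConditions (M : Model ι) : Prop where
  disjoint_E : ∀ i j, i ≠ j → interior (M.E i).toSet ∩ interior (M.E j).toSet = ∅
  disjoint_S : ∀ i j, i ≠ j → interior (M.S i).toSet ∩ interior (M.S j).toSet = ∅
  full_measure :
    MeasureTheory.volume (unitSquare \ ⋃ i, interior (M.E i).toSet) = 0
  summable_width :
    Summable fun i => -(maxWidth (M.E i).toSet * Real.log (minWidth (M.E i).toSet))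

/-- The hyperbolicity conditions with constants `α` and `K₀`. -/
structure HyperbolicityConditions (M : Model ι) (α K₀ : ℝ) : Prop where
  cone_u : ∀ i, ∀ z ∈ (M.E i).toSet,
    |(partialX (M.f i) z).2| + α * |(partialY (M.f i) z).2| + α ^ 2 * |(partialY (M.f i) z).1|
      ≤ α * |(partialX (M.f i) z).1|
  expansion_u : ∀ i, ∀ z ∈ (M.E i).toSet,
    K₀ ≤ |(partialX (M.f i) z).1| - α * |(partialY (M.f i) z).1|
  cone_s : ∀ i, ∀ z ∈ (M.E i).toSet,
    |(partialY (M.f i) z).1| + α * |(partialY (M.f i) z).2| + α ^ 2 * |(partialX (M.f i) z).2|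
      ≤ α * |(partialX (M.f i) z).1|
  expansion_s : ∀ i, ∀ z ∈ (M.E i).toSet,
    absJacobian (M.f i) z * K₀ ≤ |(partialX (M.f i) z).1| - α * |(partialX (M.f i) z).2|
  constants : 1 / K₀ ^ 2 + α ^ 2 < 1

/-- The distortion condition with constant `C₀`. -/
def DistortionCondition (M : Model ι) (C₀ : ℝ) : Prop :=
  ∀ i, ∀ z ∈ (M.E i).toSet, secondDerivSize (M.f i) z / ‖partialX (M.f i) z‖ < C₀

/-- The full width strip `S_{i₋ₙ … i₋₁}` of a past `ω`, where `ω k` stands for `i₋₍ₖ₊₁₎`: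
`S_{i₋ₙ … i₋₁} = f_{i₋₁} (S_{i₋ₙ … i₋₂} ∩ E_{i₋₁})`, and the strip of the empty word is `Q`. -/
def strip (M : Model ι) : ℕ → (ℕ → ι) → Set (ℝ × ℝ)
  | 0, _ => unitSquare
  | n + 1, ω => M.f (ω 0) '' (M.strip n (fun k => ω (k + 1)) ∩ (M.E (ω 0)).toSet)

/-- The unstable manifold `⋂_{n ≥ 1} S_{i₋ₙ … i₋₁}` of a past `ω`. -/
def unstableManifold (M : Model ι) (ω : ℕ → ι) : Set (ℝ × ℝ) := ⋂ n : ℕ, M.strip (n + 1) ω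

/-- The topological attractor `Λ`. -/
def attractor (M : Model ι) : Set (ℝ × ℝ) := ⋃ ω : ℕ → ι, M.unstableManifold ω

/-- `W` is an unstable manifold of the point `z`. (A point where several strips touch may have more
than one.) -/
def IsUnstableManifoldAt (M : Model ι) (z : ℝ × ℝ) (W : Set (ℝ × ℝ)) : Prop :=
  z ∈ W ∧ ∃ ω : ℕ → ι, W = M.unstableManifold ω

end Model

/-- The length (in the max norm) of a curve in the plane, viewed as a set: its one-dimensional
Hausdorff measure. As a real number it is positive only if that measure is positive and finite. -/
def curveLength (W : Set (ℝ × ℝ)) : ℝ := (MeasureTheory.Measure.hausdorffMeasure 1 W).toReal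

end CountableMarkov

end

/-! The horizontal expansion `|F₁ₓ|` of `f i` is almost constant on `E i`, and every unstable
manifold crosses `E i` in a piece that `f i` stretches to full width. Each piece therefore has
length comparable to `1 / |F₁ₓ(p)|`, for any fixed `p` in `E i`, and the ratio of two such lengths
is bounded.

Geometry: the inequalities on the derivatives make `f i` preserve the unstable cone `|Δy| ≤ α|Δx|`
(`image_cone`) and its inverse preserve the stable cone, with vertical contraction by `K₀`
(`preimage_cone`). Hence the sides of `E i` and `S i` are `α`-Lipschitz, and segments in the
appropriate cone stay inside these regions. A strip of depth `n` contains an `α`-Lipschitz graph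
over `[0, 1]` (`isConeGraph_image`, iterated) and has vertical thickness at most `K₀⁻ⁿ`
(`strip_thickness`), so unstable manifolds are themselves such graphs. Prepending `i` to the past
shows that the piece in `E i` maps onto full width (`image_fst_unstableManifold`).

Distortion: along a curve, `log |F₁ₓ|` varies at rate at most `C₀(|γ₁'| + |γ₂'|)`. Any two points of
`E i` are joined by a horizontal segment, a stable curve between points of the left side, and
another horizontal segment, at a total cost of at most `4C₀` (`abs_partialX_le`). The mean value
theorem and `hausdorffMeasure_bounds` then give `curveLength_bounds`. -/

namespace CountableMarkov

open Set MeasureTheory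
open scoped NNReal ENNReal Topology

/-! ### Calculus on the unit interval and length of sets -/

/-- A consequence of Cauchy's mean value theorem. -/
theorem abs_sub_le_of_abs_deriv_le {u v u' v' : ℝ → ℝ} {C : ℝ}
    (hu : ∀ t ∈ Icc (0 : ℝ) 1, HasDerivAt u (u' t) t)
    (hv : ∀ t ∈ Icc (0 : ℝ) 1, HasDerivAt v (v' t) t)
    (hv₀ : ∀ t ∈ Icc (0 : ℝ) 1, v' t ≠ 0)
    (h : ∀ t ∈ Icc (0 : ℝ) 1, |u' t| ≤ C * |v' t|) :
    |u 1 - u 0| ≤ C * |v 1 - v 0| := by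
  obtain ⟨t, ht, e⟩ := exists_ratio_hasDerivAt_eq_ratio_slope u u' zero_lt_one
    (fun t ht => (hu t ht).continuousAt.continuousWithinAt)
    (fun t ht => hu t (Ioo_subset_Icc_self ht)) v v'
    (fun t ht => (hv t ht).continuousAt.continuousWithinAt)
    (fun t ht => hv t (Ioo_subset_Icc_self ht))
  have ht' := Ioo_subset_Icc_self ht
  have h1 : 0 < |v' t| := abs_pos.2 (hv₀ t ht')
  have h2 : |v 1 - v 0| * |u' t| = |u 1 - u 0| * |v' t| := by rw [← abs_mul, e, abs_mul]
  have h3 := mul_le_mul_of_nonneg_left (h t ht') (abs_nonneg (v 1 - v 0))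
  nlinarith

theorem exists_abs_sub_eq_abs_deriv {v v' : ℝ → ℝ}
    (hv : ∀ t ∈ Icc (0 : ℝ) 1, HasDerivAt v (v' t) t) :
    ∃ t ∈ Icc (0 : ℝ) 1, v 1 - v 0 = v' t := by
  obtain ⟨t, ht, e⟩ := exists_hasDerivAt_eq_slope v v' zero_lt_one
    (fun t ht => (hv t ht).continuousAt.continuousWithinAt)
    (fun t ht => hv t (Ioo_subset_Icc_self ht))
  exact ⟨t, Ioo_subset_Icc_self ht, by simpa using e.symm⟩

/-- Connectedness of the interval. It serves to show that a single side of a region goes into a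
single side, since `MapsOnto` only speaks of pairs of sides. -/
theorem exists_eq_const_of_mem_pair {g : ℝ → ℝ} (hg : ContinuousOn g (Icc 0 1))
    (h : ∀ t ∈ Icc (0 : ℝ) 1, g t = 0 ∨ g t = 1) :
    ∃ a, (a = 0 ∨ a = 1) ∧ ∀ t ∈ Icc (0 : ℝ) 1, g t = a := by
  obtain ⟨a, ha, e⟩ := isPreconnected_Icc.eqOn_const_of_mapsTo (T := ({0, 1} : Set ℝ))
    (Set.toFinite _).isDiscrete hg (fun t ht => by simpa using h t ht) ⟨0, by simp⟩
  exact ⟨a, by simpa using ha, fun t ht => e ht⟩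

theorem fderiv_apply_eq_partial (F : ℝ × ℝ → ℝ × ℝ) (z v : ℝ × ℝ) :
    fderiv ℝ F z v = v.1 • partialX F z + v.2 • partialY F z := by
  rw [partialX, partialY, ← map_smul, ← map_smul, ← map_add]
  congr 1
  ext <;> simp

/-- A bijection from a set onto `[0, 1]` with bounded dilatation controls the length of the set. -/
theorem hausdorffMeasure_bounds {A : Set (ℝ × ℝ)} {g : ℝ × ℝ → ℝ} (hg : g '' A = Icc 0 1)
    {a b : ℝ} (ha : 0 < a) (hb : 0 < b)
    (hlow : ∀ z ∈ A, ∀ w ∈ A, a * dist z w ≤ |g z - g w|)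
    (hup : ∀ z ∈ A, ∀ w ∈ A, |g z - g w| ≤ b * dist z w) :
    b⁻¹ ≤ curveLength A ∧ curveLength A ≤ a⁻¹ := by
  have hI : Measure.hausdorffMeasure 1 (Icc (0 : ℝ) 1) = 1 := by
    rw [hausdorffMeasure_real]; simp
  have h1 : (1 : ℝ≥0∞) ≤ ENNReal.ofReal b * Measure.hausdorffMeasure 1 A := by
    have hL : LipschitzOnWith b.toNNReal g A := LipschitzOnWith.of_dist_le_mul fun z hz w hw => by
      rw [Real.dist_eq, Real.coe_toNNReal _ hb.le]; exact hup z hz w hw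
    have := hL.hausdorffMeasure_image_le (d := 1) zero_le_one
    rw [hg, hI] at this
    simpa [ENNReal.ofReal] using this
  have h2 : Measure.hausdorffMeasure 1 A ≤ ENNReal.ofReal a⁻¹ := by
    have hs : ∀ t ∈ Icc (0 : ℝ) 1, ∃ z, z ∈ A ∧ g z = t := fun t ht => by
      rw [← hg] at ht; obtain ⟨z, hz, e⟩ := ht; exact ⟨z, hz, e⟩
    choose! k hkA hk using hs
    have hL : LipschitzOnWith a⁻¹.toNNReal k (Icc 0 1) :=
      LipschitzOnWith.of_dist_le_mul fun s hs t ht => by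
        have := hlow _ (hkA s hs) _ (hkA t ht)
        rw [hk s hs, hk t ht] at this
        rw [Real.dist_eq, Real.coe_toNNReal _ (inv_pos.2 ha).le, inv_mul_eq_div, le_div_iff₀ ha]
        linarith
    -- The lower bound makes `g` injective on `A`, so its section `k` reaches all of `A`.
    have hsub : A ⊆ k '' Icc 0 1 := fun z hz => by
      have hz' : g z ∈ Icc (0 : ℝ) 1 := hg ▸ mem_image_of_mem g hz
      refine ⟨g z, hz', ?_⟩
      have := hlow _ (hkA _ hz') _ hz
      rw [hk _ hz', sub_self, abs_zero] at this
      exact dist_le_zero.1 (by nlinarith [dist_nonneg (x := k (g z)) (y := z)])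
    refine (measure_mono hsub).trans ?_
    have := hL.hausdorffMeasure_image_le (d := 1) zero_le_one
    rw [hI] at this
    simpa [ENNReal.ofReal] using this
  have hfin : Measure.hausdorffMeasure 1 A ≠ ⊤ := ne_top_of_le_ne_top ENNReal.ofReal_ne_top h2
  constructor
  · have := ENNReal.toReal_mono (ENNReal.mul_ne_top ENNReal.ofReal_ne_top hfin) h1
    rw [ENNReal.toReal_mul, ENNReal.toReal_ofReal hb.le, ENNReal.toReal_one] at this
    rw [inv_le_iff_one_le_mul₀' hb]
    exact this
  · exact ENNReal.toReal_le_of_le_ofReal (inv_pos.2 ha).le h2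

/-! ### Rectangles, strips and the maps between them -/

namespace FullHeightRect

theorem left_mem (E : FullHeightRect) {y : ℝ} (hy : y ∈ Icc (0 : ℝ) 1) :
    (E.left y, y) ∈ E.toSet := ⟨hy, le_rfl, (E.left_lt_right y hy).le⟩

theorem right_mem (E : FullHeightRect) {y : ℝ} (hy : y ∈ Icc (0 : ℝ) 1) :
    (E.right y, y) ∈ E.toSet := ⟨hy, (E.left_lt_right y hy).le, le_rfl⟩

theorem toSet_subset_unitSquare (E : FullHeightRect) : E.toSet ⊆ unitSquare := fun _ hz =>
  ⟨⟨(E.left_nonneg _ hz.1).trans hz.2.1, hz.2.2.trans (E.right_le_one _ hz.1)⟩, hz.1⟩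

theorem isCompact_toSet (E : FullHeightRect) : IsCompact E.toSet := by
  have hc : ContinuousOn (fun p : ℝ × ℝ => ((1 - p.1) * E.left p.2 + p.1 * E.right p.2, p.2))
      (Icc 0 1 ×ˢ Icc 0 1) := by
    have h1 : ContinuousOn (fun p : ℝ × ℝ => E.left p.2) (Icc 0 1 ×ˢ Icc 0 1) :=
      E.continuousOn_left.comp continuousOn_snd fun p hp => hp.2
    have h2 : ContinuousOn (fun p : ℝ × ℝ => E.right p.2) (Icc 0 1 ×ˢ Icc 0 1) :=
      E.continuousOn_right.comp continuousOn_snd fun p hp => hp.2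
    fun_prop
  convert (isCompact_Icc.prod isCompact_Icc).image_of_continuousOn hc using 1
  ext ⟨x, y⟩
  simp only [toSet, mem_ofPred_eq, mem_image, mem_prod, Prod.exists, Prod.mk.injEq]
  constructor
  · rintro ⟨hy, h1, h2⟩
    have h := E.left_lt_right y hy
    have h0 : (0 : ℝ) < E.right y - E.left y := by linarith
    refine ⟨(x - E.left y) / (E.right y - E.left y), y,
      ⟨⟨div_nonneg (by linarith) h0.le, (div_le_one h0).2 (by linarith)⟩, hy⟩, ?_, rfl⟩
    field_simp
    ring
  · rintro ⟨t, y', ⟨⟨ht0, ht1⟩, hy⟩, h1, rfl⟩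
    have h := E.left_lt_right y' hy
    refine ⟨hy, ?_, ?_⟩ <;> nlinarith

end FullHeightRect

namespace FullWidthStrip

theorem toSet_subset_unitSquare (S : FullWidthStrip) : S.toSet ⊆ unitSquare := fun _ hz =>
  ⟨hz.1, ⟨(S.bottom_nonneg _ hz.1).trans hz.2.1, hz.2.2.trans (S.top_le_one _ hz.1)⟩⟩

theorem bottom_mem (S : FullWidthStrip) {x : ℝ} (hx : x ∈ Icc (0 : ℝ) 1) :
    (x, S.bottom x) ∈ S.toSet := ⟨hx, le_rfl, (S.bottom_lt_top x hx).le⟩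

theorem top_mem (S : FullWidthStrip) {x : ℝ} (hx : x ∈ Icc (0 : ℝ) 1) :
    (x, S.top x) ∈ S.toSet := ⟨hx, (S.bottom_lt_top x hx).le, le_rfl⟩

end FullWidthStrip

namespace MapsOnto

variable {f : OpenPartialHomeomorph (ℝ × ℝ) (ℝ × ℝ)} {E : FullHeightRect} {S : FullWidthStrip}

theorem contDiffAt (h : MapsOnto f E S) {z : ℝ × ℝ} (hz : z ∈ E.toSet) : ContDiffAt ℝ 2 f z :=
  h.contDiffOn.contDiffAt (f.open_source.mem_nhds (h.subset_source hz))

theorem hasFDerivAt (h : MapsOnto f E S) {z : ℝ × ℝ} (hz : z ∈ E.toSet) :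
    HasFDerivAt f (fderiv ℝ f z) z :=
  ((h.contDiffAt hz).differentiableAt (by norm_num)).hasFDerivAt

theorem continuousOn (h : MapsOnto f E S) : ContinuousOn f E.toSet :=
  f.continuousOn.mono h.subset_source

theorem map_mem (h : MapsOnto f E S) {z : ℝ × ℝ} (hz : z ∈ E.toSet) : f z ∈ S.toSet :=
  h.image_eq ▸ mem_image_of_mem f hz

theorem symm_map (h : MapsOnto f E S) {z : ℝ × ℝ} (hz : z ∈ E.toSet) : f.symm (f z) = z :=
  f.left_inv (h.subset_source hz)

theorem injOn (h : MapsOnto f E S) : InjOn f E.toSet := f.injOn.mono h.subset_source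

theorem subset_target (h : MapsOnto f E S) : S.toSet ⊆ f.target := by
  rw [← h.image_eq]
  rintro _ ⟨z, hz, rfl⟩
  exact f.map_source (h.subset_source hz)

theorem symm_mem (h : MapsOnto f E S) {w : ℝ × ℝ} (hw : w ∈ S.toSet) : f.symm w ∈ E.toSet := by
  rw [← h.image_eq] at hw
  obtain ⟨z, hz, rfl⟩ := hw
  rwa [h.symm_map hz]

theorem map_symm (h : MapsOnto f E S) {w : ℝ × ℝ} (hw : w ∈ S.toSet) : f (f.symm w) = w :=
  f.right_inv (h.subset_target hw)

end MapsOnto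

/-! ### Segments inside rectangles and strips -/

theorem hasDerivAt_segment (z w : ℝ × ℝ) (t : ℝ) :
    HasDerivAt (fun s : ℝ => z + s • (w - z)) (w - z) t := by
  simpa using ((hasDerivAt_id t).smul_const (w - z)).const_add z

theorem hasDerivAt_fst {γ : ℝ → ℝ × ℝ} {v : ℝ × ℝ} {t : ℝ} (h : HasDerivAt γ v t) :
    HasDerivAt (fun s => (γ s).1) v.1 t :=
  (ContinuousLinearMap.fst ℝ ℝ ℝ).hasFDerivAt.comp_hasDerivAt t h

theorem hasDerivAt_snd {γ : ℝ → ℝ × ℝ} {v : ℝ × ℝ} {t : ℝ} (h : HasDerivAt γ v t) :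
    HasDerivAt (fun s => (γ s).2) v.2 t :=
  (ContinuousLinearMap.snd ℝ ℝ ℝ).hasFDerivAt.comp_hasDerivAt t h

theorem segment_vertical_subset (S : FullWidthStrip) {z w : ℝ × ℝ} (hz : z ∈ S.toSet)
    (hw : w ∈ S.toSet) (h : z.1 = w.1) : ∀ t ∈ Icc (0 : ℝ) 1, z + t • (w - z) ∈ S.toSet := by
  rintro t ⟨ht0, ht1⟩
  obtain ⟨z1, z2⟩ := z
  obtain ⟨w1, w2⟩ := w
  obtain rfl : z1 = w1 := h
  obtain ⟨h1, h2, h3⟩ := hz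
  obtain ⟨-, h4, h5⟩ := hw
  simp only at h1 h2 h3 h4 h5
  simp only [FullWidthStrip.toSet, mem_ofPred_eq, Prod.mk_sub_mk, Prod.smul_mk, Prod.mk_add_mk,
    sub_self, smul_eq_mul, mul_zero, add_zero]
  exact ⟨h1, by nlinarith, by nlinarith⟩

theorem segment_horizontal_subset (E : FullHeightRect) {z w : ℝ × ℝ} (hz : z ∈ E.toSet)
    (hw : w ∈ E.toSet) (h : z.2 = w.2) : ∀ t ∈ Icc (0 : ℝ) 1, z + t • (w - z) ∈ E.toSet := by
  rintro t ⟨ht0, ht1⟩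
  obtain ⟨z1, z2⟩ := z
  obtain ⟨w1, w2⟩ := w
  obtain rfl : z2 = w2 := h
  obtain ⟨h1, h2, h3⟩ := hz
  obtain ⟨-, h4, h5⟩ := hw
  simp only at h1 h2 h3 h4 h5
  simp only [FullHeightRect.toSet, mem_ofPred_eq, Prod.mk_sub_mk, Prod.smul_mk, Prod.mk_add_mk,
    sub_self, smul_eq_mul, mul_zero, add_zero]
  exact ⟨h1, by nlinarith, by nlinarith⟩

/-- Over a height change `|Δy|` a side drifts horizontally by at most `α|Δy| ≤ α²|Δx| ≤ |Δx|`, so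
the segment cannot overtake it. The left side is compared at the endpoint with smaller abscissa, the
right side at the other one. -/
theorem FullHeightRect.segment_subset (E : FullHeightRect) {α : ℝ} (hα₀ : 0 < α) (hα₁ : α < 1)
    (hl : ∀ y ∈ Icc (0 : ℝ) 1, ∀ y' ∈ Icc (0 : ℝ) 1, |E.left y - E.left y'| ≤ α * |y - y'|)
    (hr : ∀ y ∈ Icc (0 : ℝ) 1, ∀ y' ∈ Icc (0 : ℝ) 1, |E.right y - E.right y'| ≤ α * |y - y'|)
    {z w : ℝ × ℝ} (hz : z ∈ E.toSet) (hw : w ∈ E.toSet) (h : |w.2 - z.2| ≤ α * |w.1 - z.1|) :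
    ∀ t ∈ Icc (0 : ℝ) 1, z + t • (w - z) ∈ E.toSet := by
  rintro t ⟨ht0, ht1⟩
  obtain ⟨x, y⟩ := z
  obtain ⟨x', y'⟩ := w
  obtain ⟨⟨a0, a1⟩, a2, a3⟩ := hz
  obtain ⟨⟨b0, b1⟩, b2, b3⟩ := hw
  simp only at a0 a1 a2 a3 b0 b1 b2 b3 h
  have hs : y + t * (y' - y) ∈ Icc (0 : ℝ) 1 := ⟨by nlinarith, by nlinarith⟩
  have e1 : |(y + t * (y' - y)) - y| = t * |y' - y| := by
    rw [add_sub_cancel_left, abs_mul, abs_of_nonneg ht0]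
  have e2 : |(y + t * (y' - y)) - y'| = (1 - t) * |y' - y| := by
    rw [show (y + t * (y' - y)) - y' = -((1 - t) * (y' - y)) by ring, abs_neg, abs_mul,
      abs_of_nonneg (by linarith)]
  have hd : α * |y' - y| ≤ |x' - x| := by nlinarith [abs_nonneg (x' - x), abs_nonneg (y' - y)]
  have k1 : α * (t * |y' - y|) ≤ t * |x' - x| := by nlinarith
  have k2 : α * ((1 - t) * |y' - y|) ≤ (1 - t) * |x' - x| := by nlinarith
  have l1 := (hl _ hs _ ⟨a0, a1⟩).trans (e1 ▸ k1)
  have l2 := (hl _ hs _ ⟨b0, b1⟩).trans (e2 ▸ k2)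
  have r1 := (hr _ hs _ ⟨a0, a1⟩).trans (e1 ▸ k1)
  have r2 := (hr _ hs _ ⟨b0, b1⟩).trans (e2 ▸ k2)
  rw [abs_le] at l1 l2 r1 r2
  show y + t * (y' - y) ∈ Icc (0 : ℝ) 1 ∧ E.left (y + t * (y' - y)) ≤ x + t * (x' - x) ∧
    x + t * (x' - x) ≤ E.right (y + t * (y' - y))
  refine ⟨hs, ?_, ?_⟩ <;> rcases le_total x x' with hx | hx
  · rw [abs_of_nonneg (by linarith)] at l1; linarith
  · rw [abs_of_nonpos (by linarith)] at l2; linarith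
  · rw [abs_of_nonneg (by linarith)] at r2; linarith
  · rw [abs_of_nonpos (by linarith)] at r1; linarith

/-- Reflection in the diagonal turns the strip into a full height rectangle. -/
theorem FullWidthStrip.segment_subset (S : FullWidthStrip) {α : ℝ} (hα₀ : 0 < α) (hα₁ : α < 1)
    (hl : ∀ x ∈ Icc (0 : ℝ) 1, ∀ x' ∈ Icc (0 : ℝ) 1, |S.bottom x - S.bottom x'| ≤ α * |x - x'|)
    (hr : ∀ x ∈ Icc (0 : ℝ) 1, ∀ x' ∈ Icc (0 : ℝ) 1, |S.top x - S.top x'| ≤ α * |x - x'|)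
    {z w : ℝ × ℝ} (hz : z ∈ S.toSet) (hw : w ∈ S.toSet) (h : |w.1 - z.1| ≤ α * |w.2 - z.2|) :
    ∀ t ∈ Icc (0 : ℝ) 1, z + t • (w - z) ∈ S.toSet := by
  let E : FullHeightRect := ⟨S.bottom, S.top, S.continuousOn_bottom, S.continuousOn_top,
    S.bottom_nonneg, S.bottom_lt_top, S.top_le_one⟩
  intro t ht
  exact E.segment_subset (z := z.swap) (w := w.swap) hα₀ hα₁ hl hr hz hw h t ht

/-! ### Invariant cones -/

namespace Model

variable {ι : Type*} {M : Model ι} {α K₀ : ℝ}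

/-- Along a segment of `E i` inside the unstable cone: its image is in the unstable cone. -/
theorem image_cone (hα₀ : 0 < α) (hK₀ : 1 < K₀)
    (hH : M.HyperbolicityConditions α K₀) (i : ι) {z w : ℝ × ℝ}
    (hseg : ∀ t ∈ Icc (0 : ℝ) 1, z + t • (w - z) ∈ (M.E i).toSet)
    (h : |w.2 - z.2| ≤ α * |w.1 - z.1|) :
    |(M.f i w).2 - (M.f i z).2| ≤ α * |(M.f i w).1 - (M.f i z).1| ∧
    ∃ p ∈ (M.E i).toSet, (M.f i w).1 - (M.f i z).1 =
      (w.1 - z.1) * (partialX (M.f i) p).1 + (w.2 - z.2) * (partialY (M.f i) p).1 := by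
  have hd : ∀ t ∈ Icc (0 : ℝ) 1, HasDerivAt (fun s : ℝ => M.f i (z + s • (w - z)))
      (fderiv ℝ (M.f i) (z + t • (w - z)) (w - z)) t := fun t ht =>
    ((M.mapsOnto i).hasFDerivAt (hseg t ht)).comp_hasDerivAt t (hasDerivAt_segment z w t)
  have h1 := fun t ht => hasDerivAt_fst (hd t ht)
  have h2 := fun t ht => hasDerivAt_snd (hd t ht)
  simp only [fderiv_apply_eq_partial, Prod.fst_add, Prod.snd_add, Prod.smul_fst, Prod.smul_snd,
    Prod.fst_sub, Prod.snd_sub, smul_eq_mul] at h1 h2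
  constructor
  · by_cases hx : w.1 - z.1 = 0
    · have hy : w.2 - z.2 = 0 := by simpa [hx] using h
      have : w = z := Prod.ext (by linarith) (by linarith)
      simp [this]
    have hx' := abs_pos.2 hx
    -- The horizontal speed is at least `|Δx|(|X₁| - α|Y₁|) ≥ K₀|Δx|`, and `cone_u` times `|Δx|`
    -- bounds the vertical speed by `α|Δx|(|X₁| - α|Y₁|)`.
    have key : ∀ t ∈ Icc (0 : ℝ) 1, ∀ X₁ X₂ Y₁ Y₂ : ℝ,
        X₁ = (partialX (M.f i) (z + t • (w - z))).1 → X₂ = (partialX (M.f i) (z + t • (w - z))).2 →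
        Y₁ = (partialY (M.f i) (z + t • (w - z))).1 → Y₂ = (partialY (M.f i) (z + t • (w - z))).2 →
        0 < |(w.1 - z.1) * X₁ + (w.2 - z.2) * Y₁| ∧
        |(w.1 - z.1) * X₂ + (w.2 - z.2) * Y₂| ≤ α * |(w.1 - z.1) * X₁ + (w.2 - z.2) * Y₁| := by
      rintro t ht X₁ X₂ Y₁ Y₂ e1 e2 e3 e4
      have c1 := hH.cone_u i _ (hseg t ht)
      have c2 := hH.expansion_u i _ (hseg t ht)
      rw [← e1, ← e2, ← e3, ← e4] at c1
      rw [← e1, ← e3] at c2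
      have b1 : |(w.1 - z.1) * X₂ + (w.2 - z.2) * Y₂| ≤ |w.1 - z.1| * |X₂| + |w.2 - z.2| * |Y₂| := by
        rw [← abs_mul, ← abs_mul]; exact abs_add_le _ _
      have b2 : |w.1 - z.1| * |X₁| - |w.2 - z.2| * |Y₁| ≤ |(w.1 - z.1) * X₁ + (w.2 - z.2) * Y₁| := by
        rw [← abs_mul, ← abs_mul]
        have := abs_sub_abs_le_abs_sub ((w.1 - z.1) * X₁) (-((w.2 - z.2) * Y₁))
        rwa [abs_neg, sub_neg_eq_add] at this
      have b3 := mul_le_mul_of_nonneg_right h (abs_nonneg Y₁)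
      have b4 := mul_le_mul_of_nonneg_right h (abs_nonneg Y₂)
      have b5 := mul_le_mul_of_nonneg_left c1 hx'.le
      have b6 := mul_le_mul_of_nonneg_left c2 hx'.le
      constructor
      · nlinarith
      · nlinarith
    have := abs_sub_le_of_abs_deriv_le (C := α) h2 h1
      (fun t ht => abs_pos.1 (key t ht _ _ _ _ rfl rfl rfl rfl).1)
      (fun t ht => (key t ht _ _ _ _ rfl rfl rfl rfl).2)
    simpa using this
  · obtain ⟨t, ht, e⟩ := exists_abs_sub_eq_abs_deriv h1
    exact ⟨_, hseg t ht, by simpa using e⟩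

/-- A segment of `S i` inside the stable cone is the image of a curve of `E i` inside the stable
cone, and its height is contracted. -/
theorem exists_preimage_curve (hα₀ : 0 < α) (hα₁ : α < 1) (hK₀ : 1 < K₀)
    (hH : M.HyperbolicityConditions α K₀) (i : ι) {p q : ℝ × ℝ} (hp : p ∈ (M.E i).toSet)
    (hq : q ∈ (M.E i).toSet) (hpq : p ≠ q)
    (hseg : ∀ t ∈ Icc (0 : ℝ) 1, M.f i p + t • (M.f i q - M.f i p) ∈ (M.S i).toSet)
    (h : |(M.f i q).1 - (M.f i p).1| ≤ α * |(M.f i q).2 - (M.f i p).2|) :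
    ∃ γ γ' : ℝ → ℝ × ℝ, γ 0 = p ∧ γ 1 = q ∧ ∀ t ∈ Icc (0 : ℝ) 1, γ t ∈ (M.E i).toSet ∧
      HasDerivAt γ (γ' t) t ∧ |(γ' t).1| ≤ α * |(γ' t).2| ∧
      K₀ * |(M.f i q).2 - (M.f i p).2| ≤ |(γ' t).2| ∧ (γ' t).2 ≠ 0 := by
  have hm := M.mapsOnto i
  set f := M.f i with hf
  set v := f q - f p with hv
  have hv2 : v.2 ≠ 0 := by
    intro h0
    change |v.1| ≤ α * |v.2| at h
    have h1 : v.1 = 0 := by simpa [h0] using h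
    exact hpq (hm.injOn hp hq (sub_eq_zero.1 (Prod.ext h1 h0 : f q - f p = 0)).symm)
  refine ⟨fun t => f.symm (f p + t • v), fun t => fderiv ℝ f.symm (f p + t • v) v,
    by simp [hm.symm_map hp], by simp [hv, hm.symm_map hq], fun t ht => ?_⟩
  have hγ := hm.symm_mem (hseg t ht)
  have hnhds : f.target ∈ 𝓝 (f p + t • v) :=
    f.open_target.mem_nhds (hm.subset_target (hseg t ht))
  have hd : HasDerivAt (fun s : ℝ => f.symm (f p + s • v))
      (fderiv ℝ f.symm (f p + t • v) v) t := by
    have h1 : HasFDerivAt f.symm (fderiv ℝ f.symm (f p + t • v)) (f p + t • v) :=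
      ((hm.contDiffOn_symm.contDiffAt hnhds).differentiableAt (by norm_num)).hasFDerivAt
    exact h1.comp_hasDerivAt t (hasDerivAt_segment (f p) (f q) t)
  set γ' := fderiv ℝ f.symm (f p + t • v) v with hγ'
  -- Differentiating `f ∘ f.symm = id` along the segment.
  have hlin : fderiv ℝ f (f.symm (f p + t • v)) γ' = v := by
    have h1 : HasDerivAt (fun s : ℝ => f (f.symm (f p + s • v)))
        (fderiv ℝ f (f.symm (f p + t • v)) γ') t :=
      (hm.hasFDerivAt hγ).comp_hasDerivAt t hd
    refine h1.unique ((hasDerivAt_segment (f p) (f q) t).congr_of_eventuallyEq ?_)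
    filter_upwards [(hasDerivAt_segment (f p) (f q) t).continuousAt.preimage_mem_nhds hnhds]
      with s hs
    exact f.right_inv hs
  rw [fderiv_apply_eq_partial] at hlin
  have e1 := congrArg Prod.fst hlin
  have e2 := congrArg Prod.snd hlin
  have c1 := hH.cone_s i _ hγ
  have c2 := hH.expansion_s i _ hγ
  have c3 := hH.expansion_u i _ hγ
  have c4 := hH.cone_u i _ hγ
  rw [absJacobian] at c2
  simp only [Prod.fst_add, Prod.snd_add, Prod.smul_fst, Prod.smul_snd, smul_eq_mul] at e1 e2
  rw [← hf] at c1 c2 c3 c4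
  generalize (partialX f (f.symm (f p + t • v))).1 = X₁ at *
  generalize (partialX f (f.symm (f p + t • v))).2 = X₂ at *
  generalize (partialY f (f.symm (f p + t • v))).1 = Y₁ at *
  generalize (partialY f (f.symm (f p + t • v))).2 = Y₂ at *
  change |v.1| ≤ α * |v.2| at h
  set J := X₁ * Y₂ - Y₁ * X₂ with hJ
  -- Cramer's rule for the linear system `Df γ' = v`, without dividing by the determinant.
  have g1 : J * γ'.1 = Y₂ * v.1 - Y₁ * v.2 := by rw [← e1, ← e2, hJ]; ring
  have g2 : J * γ'.2 = X₁ * v.2 - X₂ * v.1 := by rw [← e1, ← e2, hJ]; ring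
  have hv2' := abs_pos.2 hv2
  have hX : 0 < |X₁| := by nlinarith [abs_nonneg Y₁]
  have k1 : |J| * |γ'.1| ≤ |Y₂| * |v.1| + |Y₁| * |v.2| := by
    rw [← abs_mul, g1, ← abs_mul, ← abs_mul]; exact abs_sub _ _
  have k2 : |X₁| * |v.2| - |X₂| * |v.1| ≤ |J| * |γ'.2| := by
    have := abs_sub_abs_le_abs_sub (X₁ * v.2) (X₂ * v.1)
    rwa [← g2, abs_mul, abs_mul, abs_mul] at this
  have m1 := mul_le_mul_of_nonneg_left h (abs_nonneg X₂)
  have m2 := mul_le_mul_of_nonneg_left h (abs_nonneg Y₂)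
  have m3 := mul_le_mul_of_nonneg_right c1 hv2'.le
  have m4 := mul_le_mul_of_nonneg_right c2 hv2'.le
  have hX2 : α * |X₂| < |X₁| := by
    have : |X₂| ≤ α * |X₁| := by
      nlinarith [abs_nonneg Y₁, mul_nonneg hα₀.le (abs_nonneg Y₂), sq_nonneg α]
    nlinarith [mul_pos (sub_pos.2 hα₁) hX, mul_nonneg (sub_pos.2 hα₁).le (abs_nonneg X₂)]
  -- It is at least `(|X₁| - α|X₂|)|v.2|`, which is positive; so the determinant does not vanish.
  have hJγ : 0 < |J| * |γ'.2| := by nlinarith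
  have hJ0 : 0 < |J| := by
    rcases (abs_nonneg J).eq_or_lt with h0 | h0
    · rw [← h0] at hJγ; simp at hJγ
    · exact h0
  have hK : K₀ * |v.2| ≤ |γ'.2| := by
    refine le_of_mul_le_mul_left ?_ hJ0
    nlinarith
  refine ⟨hγ, hd, le_of_mul_le_mul_left ?_ hJ0, hK, ?_⟩
  · nlinarith
  · exact abs_pos.1 (by nlinarith)

/-- Pairs of points in the stable cone pull back to such pairs, with expansion. -/
theorem preimage_cone (hα₀ : 0 < α) (hα₁ : α < 1) (hK₀ : 1 < K₀)
    (hH : M.HyperbolicityConditions α K₀) (i : ι) {p q : ℝ × ℝ} (hp : p ∈ (M.E i).toSet)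
    (hq : q ∈ (M.E i).toSet)
    (hseg : ∀ t ∈ Icc (0 : ℝ) 1, M.f i p + t • (M.f i q - M.f i p) ∈ (M.S i).toSet)
    (h : |(M.f i q).1 - (M.f i p).1| ≤ α * |(M.f i q).2 - (M.f i p).2|) :
    |q.1 - p.1| ≤ α * |q.2 - p.2| ∧ K₀ * |(M.f i q).2 - (M.f i p).2| ≤ |q.2 - p.2| := by
  by_cases hpq : p = q
  · simp [hpq]
  obtain ⟨γ, γ', rfl, rfl, hγ⟩ := exists_preimage_curve hα₀ hα₁ hK₀ hH i hp hq hpq hseg h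
  have h1 := fun t ht => hasDerivAt_fst (hγ t ht).2.1
  have h2 := fun t ht => hasDerivAt_snd (hγ t ht).2.1
  refine ⟨abs_sub_le_of_abs_deriv_le h1 h2 (fun t ht => (hγ t ht).2.2.2.2)
    (fun t ht => (hγ t ht).2.2.1), ?_⟩
  obtain ⟨t, ht, e⟩ := exists_abs_sub_eq_abs_deriv h2
  rw [e]
  exact (hγ t ht).2.2.2.1

end Model

/-! ### Lipschitz sides and the graph transform -/

/-- A set in the square that is the graph over `[0, 1]` of an `α`-Lipschitz function. -/
structure IsConeGraph (α : ℝ) (Γ : Set (ℝ × ℝ)) : Prop where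
  subset : Γ ⊆ unitSquare
  cone : ∀ z ∈ Γ, ∀ w ∈ Γ, |w.2 - z.2| ≤ α * |w.1 - z.1|
  exists_fst_eq : ∀ x ∈ Icc (0 : ℝ) 1, ∃ z ∈ Γ, z.1 = x

namespace Model

variable {ι : Type*} {M : Model ι} {α K₀ : ℝ}

/-- Continuity makes the abscissa constant on the image of each lateral side. The two constants
differ because the images together cover both lateral sides of the strip. -/
theorem exists_fst_lateral (i : ι) : ∃ a b : ℝ, ((a = 0 ∧ b = 1) ∨ (a = 1 ∧ b = 0)) ∧
    (∀ y ∈ Icc (0 : ℝ) 1, (M.f i ((M.E i).left y, y)).1 = a) ∧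
    ∀ y ∈ Icc (0 : ℝ) 1, (M.f i ((M.E i).right y, y)).1 = b := by
  have hm := M.mapsOnto i
  have key : ∀ z ∈ (M.E i).lateralSides, (M.f i z).1 = 0 ∨ (M.f i z).1 = 1 := fun z hz =>
    (hm.image_lateralSides ▸ mem_image_of_mem (M.f i) hz : M.f i z ∈ (M.S i).lateralSides).2
  have hl : ContinuousOn (fun y => (M.f i ((M.E i).left y, y)).1) (Icc 0 1) :=
    continuous_fst.comp_continuousOn (hm.continuousOn.comp
      ((M.E i).continuousOn_left.prodMk continuousOn_id) fun y hy => (M.E i).left_mem hy)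
  have hr : ContinuousOn (fun y => (M.f i ((M.E i).right y, y)).1) (Icc 0 1) :=
    continuous_fst.comp_continuousOn (hm.continuousOn.comp
      ((M.E i).continuousOn_right.prodMk continuousOn_id) fun y hy => (M.E i).right_mem hy)
  obtain ⟨a, ha, hla⟩ := exists_eq_const_of_mem_pair hl fun y hy => key _ ⟨hy, .inl rfl⟩
  obtain ⟨b, hb, hrb⟩ := exists_eq_const_of_mem_pair hr fun y hy => key _ ⟨hy, .inr rfl⟩
  refine ⟨a, b, ?_, hla, hrb⟩
  have hab : a ≠ b := by
    rintro rfl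
    have : ∀ w ∈ (M.S i).lateralSides, w.1 = a := by
      rw [← hm.image_lateralSides]
      rintro _ ⟨⟨x, y⟩, ⟨hy, h⟩, rfl⟩
      rcases h with h | h
      · exact (congrArg (fun t => (M.f i (t, y)).1) h).trans (hla y hy)
      · exact (congrArg (fun t => (M.f i (t, y)).1) h).trans (hrb y hy)
    have h0 := this _ ⟨(M.S i).bottom_mem (left_mem_Icc.2 zero_le_one), .inl rfl⟩
    have h1 := this _ ⟨(M.S i).bottom_mem (right_mem_Icc.2 zero_le_one), .inr rfl⟩
    simp only at h0 h1
    linarith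
  rcases ha with rfl | rfl <;> rcases hb with rfl | rfl <;> simp at hab ⊢

theorem vertical_pair (i : ι) {p q : ℝ × ℝ} (hp : p ∈ (M.E i).toSet) (hq : q ∈ (M.E i).toSet)
    (h : (M.f i p).1 = (M.f i q).1) (hα₀ : 0 < α) :
    (∀ t ∈ Icc (0 : ℝ) 1, M.f i p + t • (M.f i q - M.f i p) ∈ (M.S i).toSet) ∧
      |(M.f i q).1 - (M.f i p).1| ≤ α * |(M.f i q).2 - (M.f i p).2| :=
  ⟨segment_vertical_subset _ ((M.mapsOnto i).map_mem hp) ((M.mapsOnto i).map_mem hq) h, by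
    rw [h, sub_self, abs_zero]; positivity⟩

/-- Two points of the curve have images on one vertical line, hence in the stable cone, which pulls
back to itself. -/
theorem lateral_lipschitz (hα₀ : 0 < α) (hα₁ : α < 1) (hK₀ : 1 < K₀)
    (hH : M.HyperbolicityConditions α K₀) (i : ι) {g : ℝ → ℝ} {a : ℝ}
    (hg : ∀ y ∈ Icc (0 : ℝ) 1, (g y, y) ∈ (M.E i).toSet)
    (ha : ∀ y ∈ Icc (0 : ℝ) 1, (M.f i (g y, y)).1 = a) :
    ∀ y ∈ Icc (0 : ℝ) 1, ∀ y' ∈ Icc (0 : ℝ) 1, |g y - g y'| ≤ α * |y - y'| := by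
  intro y hy y' hy'
  obtain ⟨h1, h2⟩ := vertical_pair i (hg y' hy') (hg y hy) ((ha y' hy').trans (ha y hy).symm) hα₀
  exact (preimage_cone hα₀ hα₁ hK₀ hH i (hg y' hy') (hg y hy) h1 h2).1

/-- The curve pulls back into a single line `y = 0` or `y = 1`, whose horizontal segments are pushed
into the unstable cone. -/
theorem horizontal_lipschitz (hα₀ : 0 < α) (hK₀ : 1 < K₀)
    (hH : M.HyperbolicityConditions α K₀) (i : ι) {g : ℝ → ℝ}
    (hc : ContinuousOn g (Icc 0 1))
    (hg : ∀ x ∈ Icc (0 : ℝ) 1, (x, g x) ∈ (M.S i).horizontalSides)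
    (hg' : ∀ x ∈ Icc (0 : ℝ) 1, (x, g x) ∈ (M.S i).toSet) :
    ∀ x ∈ Icc (0 : ℝ) 1, ∀ x' ∈ Icc (0 : ℝ) 1, |g x - g x'| ≤ α * |x - x'| := by
  have hm := M.mapsOnto i
  have key : ∀ x ∈ Icc (0 : ℝ) 1, ((M.f i).symm (x, g x)).2 = 0 ∨
      ((M.f i).symm (x, g x)).2 = 1 := fun x hx => by
    have h1 := hg x hx
    rw [← hm.image_horizontalSides] at h1
    obtain ⟨z, hz, e⟩ := h1
    rw [← e, hm.symm_map hz.1]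
    exact hz.2
  have hcs : ContinuousOn (fun x => ((M.f i).symm (x, g x)).2) (Icc 0 1) :=
    continuous_snd.comp_continuousOn ((M.f i).continuousOn_symm.comp
      (continuousOn_id.prodMk hc) fun x hx => hm.subset_target (hg' x hx))
  obtain ⟨a, -, ha⟩ := exists_eq_const_of_mem_pair hcs key
  intro x hx x' hx'
  have e : ((M.f i).symm (x', g x')).2 = ((M.f i).symm (x, g x)).2 :=
    (ha x' hx').trans (ha x hx).symm
  have := (image_cone hα₀ hK₀ hH i
    (segment_horizontal_subset _ (hm.symm_mem (hg' x' hx')) (hm.symm_mem (hg' x hx)) e)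
    (by rw [e, sub_self, abs_zero]; positivity)).1
  rwa [hm.map_symm (hg' x hx), hm.map_symm (hg' x' hx')] at this

theorem left_lipschitz (hα₀ : 0 < α) (hα₁ : α < 1) (hK₀ : 1 < K₀)
    (hH : M.HyperbolicityConditions α K₀) (i : ι) :
    ∀ y ∈ Icc (0 : ℝ) 1, ∀ y' ∈ Icc (0 : ℝ) 1,
      |(M.E i).left y - (M.E i).left y'| ≤ α * |y - y'| :=
  have ⟨_, _, _, hl, _⟩ := exists_fst_lateral (M := M) i
  lateral_lipschitz hα₀ hα₁ hK₀ hH i (fun _ hy => (M.E i).left_mem hy) hl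

theorem right_lipschitz (hα₀ : 0 < α) (hα₁ : α < 1) (hK₀ : 1 < K₀)
    (hH : M.HyperbolicityConditions α K₀) (i : ι) :
    ∀ y ∈ Icc (0 : ℝ) 1, ∀ y' ∈ Icc (0 : ℝ) 1,
      |(M.E i).right y - (M.E i).right y'| ≤ α * |y - y'| :=
  have ⟨_, _, _, _, hr⟩ := exists_fst_lateral (M := M) i
  lateral_lipschitz hα₀ hα₁ hK₀ hH i (fun _ hy => (M.E i).right_mem hy) hr

theorem segment_subset_E (hα₀ : 0 < α) (hα₁ : α < 1) (hK₀ : 1 < K₀)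
    (hH : M.HyperbolicityConditions α K₀) (i : ι) {z w : ℝ × ℝ} (hz : z ∈ (M.E i).toSet)
    (hw : w ∈ (M.E i).toSet) (h : |w.2 - z.2| ≤ α * |w.1 - z.1|) :
    ∀ t ∈ Icc (0 : ℝ) 1, z + t • (w - z) ∈ (M.E i).toSet :=
  (M.E i).segment_subset hα₀ hα₁ (left_lipschitz hα₀ hα₁ hK₀ hH i)
    (right_lipschitz hα₀ hα₁ hK₀ hH i) hz hw h

theorem segment_subset_S (hα₀ : 0 < α) (hα₁ : α < 1) (hK₀ : 1 < K₀)
    (hH : M.HyperbolicityConditions α K₀) (i : ι) {z w : ℝ × ℝ} (hz : z ∈ (M.S i).toSet)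
    (hw : w ∈ (M.S i).toSet) (h : |w.1 - z.1| ≤ α * |w.2 - z.2|) :
    ∀ t ∈ Icc (0 : ℝ) 1, z + t • (w - z) ∈ (M.S i).toSet :=
  (M.S i).segment_subset hα₀ hα₁
    (horizontal_lipschitz hα₀ hK₀ hH i (M.S i).continuousOn_bottom
      (fun _ hx => ⟨hx, .inl rfl⟩) fun _ hx => (M.S i).bottom_mem hx)
    (horizontal_lipschitz hα₀ hK₀ hH i (M.S i).continuousOn_top
      (fun _ hx => ⟨hx, .inr rfl⟩) fun _ hx => (M.S i).top_mem hx) hz hw h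

/-- The graph transform. -/
theorem isConeGraph_image (hα₀ : 0 < α) (hα₁ : α < 1) (hK₀ : 1 < K₀)
    (hH : M.HyperbolicityConditions α K₀) (i : ι) {Γ : Set (ℝ × ℝ)} (hΓ : IsConeGraph α Γ) :
    IsConeGraph α (M.f i '' (Γ ∩ (M.E i).toSet)) := by
  have hm := M.mapsOnto i
  refine ⟨?_, ?_, ?_⟩
  · rintro _ ⟨z, hz, rfl⟩
    exact (M.S i).toSet_subset_unitSquare (hm.map_mem hz.2)
  · rintro _ ⟨z, hz, rfl⟩ _ ⟨w, hw, rfl⟩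
    have h := hΓ.cone z hz.1 w hw.1
    exact (image_cone hα₀ hK₀ hH i (segment_subset_E hα₀ hα₁ hK₀ hH i hz.2 hw.2 h) h).1
  intro s hs
  have hw : ∀ x ∈ Icc (0 : ℝ) 1, ∃ y, (x, y) ∈ Γ := fun x hx => by
    obtain ⟨z, hz, rfl⟩ := hΓ.exists_fst_eq x hx
    exact ⟨z.2, hz⟩
  choose! g hg using hw
  have hgL : ∀ x ∈ Icc (0 : ℝ) 1, ∀ x' ∈ Icc (0 : ℝ) 1, |g x - g x'| ≤ α * |x - x'| :=
    fun x hx x' hx' => hΓ.cone _ (hg x' hx') _ (hg x hx)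
  have hgI : ∀ x ∈ Icc (0 : ℝ) 1, g x ∈ Icc (0 : ℝ) 1 := fun x hx => (hΓ.subset (hg x hx)).2
  have hgc : ContinuousOn g (Icc 0 1) := by
    refine (LipschitzOnWith.of_dist_le_mul (K := α.toNNReal) fun x hx x' hx' => ?_).continuousOn
    rw [Real.coe_toNNReal _ hα₀.le]
    exact hgL x hx x' hx'
  -- The composite `k ∘ g` is `α²`-Lipschitz, so the graph of `g` crosses the side `x = k y` in one
  -- direction only.
  have contr : ∀ {k : ℝ → ℝ}, (∀ y ∈ Icc (0 : ℝ) 1, ∀ y' ∈ Icc (0 : ℝ) 1,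
      |k y - k y'| ≤ α * |y - y'|) → ∀ x ∈ Icc (0 : ℝ) 1, ∀ x' ∈ Icc (0 : ℝ) 1, x ≤ x' →
      |k (g x') - k (g x)| ≤ x' - x := fun {k} hk x hx x' hx' hxx => by
    have h1 := hk _ (hgI x' hx') _ (hgI x hx)
    have h2 := hgL x' hx' x hx
    rw [abs_of_nonneg (sub_nonneg.2 hxx)] at h2
    nlinarith [mul_nonneg hα₀.le (sub_nonneg.2 hxx), mul_le_mul_of_nonneg_left h2 hα₀.le]
  have root : ∀ {k : ℝ → ℝ}, ContinuousOn k (Icc 0 1) → (∀ y ∈ Icc (0 : ℝ) 1, 0 ≤ k y) →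
      (∀ y ∈ Icc (0 : ℝ) 1, k y ≤ 1) → ∃ x ∈ Icc (0 : ℝ) 1, x = k (g x) :=
    fun {k} hk h0 h1 => by
    have hc : ContinuousOn (fun x => x - k (g x)) (Icc 0 1) :=
      continuousOn_id.sub (hk.comp hgc hgI)
    have m0 := left_mem_Icc.2 (zero_le_one' ℝ)
    have m1 := right_mem_Icc.2 (zero_le_one' ℝ)
    obtain ⟨x, hx, e⟩ := intermediate_value_Icc zero_le_one hc
      (show (0 : ℝ) ∈ Icc _ _ from ⟨by linarith [h0 _ (hgI _ m0)], by linarith [h1 _ (hgI _ m1)]⟩)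
    exact ⟨x, hx, sub_eq_zero.1 e⟩
  have hLR := (M.E i).left_lt_right
  obtain ⟨x₀, hx₀, e₀⟩ := root (M.E i).continuousOn_left (M.E i).left_nonneg
    fun y hy => (hLR y hy).le.trans ((M.E i).right_le_one y hy)
  obtain ⟨x₁, hx₁, e₁⟩ := root (M.E i).continuousOn_right
    (fun y hy => ((M.E i).left_nonneg y hy).trans (hLR y hy).le) (M.E i).right_le_one
  have hL := left_lipschitz hα₀ hα₁ hK₀ hH i
  have hR := right_lipschitz hα₀ hα₁ hK₀ hH i
  -- Otherwise `right (g x₀) ≤ x₁ + (x₀ - x₁) = x₀ = left (g x₀)`.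
  have hx₀₁ : x₀ ≤ x₁ := by
    by_contra! hlt
    have h1 := (abs_le.1 (contr hR x₁ hx₁ x₀ hx₀ hlt.le)).2
    have := hLR _ (hgI x₀ hx₀)
    linarith
  have hsub : Icc x₀ x₁ ⊆ Icc 0 1 := Icc_subset_Icc hx₀.1 hx₁.2
  have hmem : ∀ x ∈ Icc x₀ x₁, (x, g x) ∈ (M.E i).toSet := fun x hx => by
    have h1 := (abs_le.1 (contr hL x₀ hx₀ x (hsub hx) hx.1)).2
    have h2 := (abs_le.1 (contr hR x (hsub hx) x₁ hx₁ hx.2)).2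
    exact ⟨hgI x (hsub hx), by simp only; linarith, by simp only; linarith⟩
  have hF : ContinuousOn (fun x => (M.f i (x, g x)).1) (uIcc x₀ x₁) := by
    rw [uIcc_of_le hx₀₁]
    exact continuous_fst.comp_continuousOn (hm.continuousOn.comp
      (continuousOn_id.prodMk (hgc.mono hsub)) hmem)
  obtain ⟨a, b, hab, hla, hrb⟩ := exists_fst_lateral (M := M) i
  have v₀ := hla _ (hgI _ hx₀)
  have v₁ := hrb _ (hgI _ hx₁)
  rw [← e₀] at v₀
  rw [← e₁] at v₁
  have hiv := intermediate_value_uIcc hF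
  simp only [v₀, v₁] at hiv
  have hs' : s ∈ uIcc a b := by
    rcases hab with ⟨rfl, rfl⟩ | ⟨rfl, rfl⟩
    · rwa [uIcc_of_le zero_le_one]
    · rwa [uIcc_of_ge zero_le_one]
  obtain ⟨x, hx, e⟩ := hiv hs'
  rw [uIcc_of_le hx₀₁] at hx
  exact ⟨_, ⟨_, ⟨hg x (hsub hx), hmem x hx⟩, rfl⟩, e⟩

/-! ### Strips and unstable manifolds -/

theorem strip_succ_subset (n : ℕ) (ω : ℕ → ι) : M.strip (n + 1) ω ⊆ (M.S (ω 0)).toSet := by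
  rw [← (M.mapsOnto (ω 0)).image_eq]
  exact image_mono inter_subset_right

theorem strip_subset_unitSquare (n : ℕ) (ω : ℕ → ι) : M.strip n ω ⊆ unitSquare := by
  cases n with
  | zero => exact subset_rfl
  | succ n => exact (strip_succ_subset n ω).trans (M.S (ω 0)).toSet_subset_unitSquare

theorem strip_succ_subset_strip (n : ℕ) (ω : ℕ → ι) : M.strip (n + 1) ω ⊆ M.strip n ω := by
  induction n generalizing ω with
  | zero => exact strip_subset_unitSquare 1 ω
  | succ n ih => exact image_mono (inter_subset_inter_left _ (ih _))

theorem isCompact_strip (n : ℕ) (ω : ℕ → ι) : IsCompact (M.strip n ω) := by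
  induction n generalizing ω with
  | zero => exact isCompact_Icc.prod isCompact_Icc
  | succ n ih =>
    exact ((ih _).inter (M.E (ω 0)).isCompact_toSet).image_of_continuousOn
      ((M.mapsOnto (ω 0)).continuousOn.mono inter_subset_right)

theorem exists_coneGraph_subset_strip (hα₀ : 0 < α) (hα₁ : α < 1) (hK₀ : 1 < K₀)
    (hH : M.HyperbolicityConditions α K₀) (n : ℕ) (ω : ℕ → ι) :
    ∃ Γ ⊆ M.strip n ω, IsConeGraph α Γ := by
  induction n generalizing ω with
  | zero =>
    have hsub : Icc (0 : ℝ) 1 ×ˢ {(0 : ℝ)} ⊆ unitSquare :=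
      prod_mono subset_rfl (singleton_subset_iff.2 (left_mem_Icc.2 zero_le_one))
    refine ⟨Icc 0 1 ×ˢ {0}, hsub, hsub, fun z hz w hw => ?_, fun x hx => ⟨(x, 0), ⟨hx, rfl⟩, rfl⟩⟩
    rw [show z.2 = 0 from hz.2, show w.2 = 0 from hw.2, sub_self, abs_zero]
    positivity
  | succ n ih =>
    obtain ⟨Γ, hs, hΓ⟩ := ih fun k => ω (k + 1)
    exact ⟨_, image_mono (inter_subset_inter_left _ hs),
      isConeGraph_image hα₀ hα₁ hK₀ hH (ω 0) hΓ⟩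

/-- Each of the `n` pullbacks stays in the stable cone and multiplies the height difference by at
least `K₀`, while the final pair still lies in the unit square. -/
theorem strip_thickness (hα₀ : 0 < α) (hα₁ : α < 1) (hK₀ : 1 < K₀)
    (hH : M.HyperbolicityConditions α K₀) (n : ℕ) (ω : ℕ → ι) {z w : ℝ × ℝ}
    (hz : z ∈ M.strip n ω) (hw : w ∈ M.strip n ω) (h : |w.1 - z.1| ≤ α * |w.2 - z.2|) :
    K₀ ^ n * |w.2 - z.2| ≤ 1 := by
  induction n generalizing ω z w with
  | zero =>
    obtain ⟨-, h1, h2⟩ := hz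
    obtain ⟨-, h3, h4⟩ := hw
    rw [pow_zero, one_mul, abs_le]
    constructor <;> linarith
  | succ n ih =>
    have hseg := segment_subset_S hα₀ hα₁ hK₀ hH (ω 0) (strip_succ_subset n ω hz)
      (strip_succ_subset n ω hw) h
    obtain ⟨p, hp, rfl⟩ := hz
    obtain ⟨q, hq, rfl⟩ := hw
    obtain ⟨h1, h2⟩ := preimage_cone hα₀ hα₁ hK₀ hH (ω 0) hp.2 hq.2 hseg h
    have h3 := ih _ hp.1 hq.1 h1
    have h4 := mul_le_mul_of_nonneg_left h2 (pow_nonneg (zero_le_one.trans hK₀.le) n)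
    rw [pow_succ, mul_assoc]
    exact h4.trans h3

/-- Unstable manifolds are graphs of `α`-Lipschitz functions. -/
theorem isConeGraph_unstableManifold (hα₀ : 0 < α) (hα₁ : α < 1) (hK₀ : 1 < K₀)
    (hH : M.HyperbolicityConditions α K₀) (ω : ℕ → ι) :
    IsConeGraph α (M.unstableManifold ω) := by
  refine ⟨(iInter_subset _ 0).trans (strip_subset_unitSquare 1 ω), fun z hz w hw => ?_,
    fun x hx => ?_⟩
  -- Both points are within `K₀⁻¹ ^ (n + 1)` of a cone graph in the strip of depth `n + 1`; the
  -- error vanishes in the limit.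
  · have hK : Filter.Tendsto (fun n : ℕ => 2 * (K₀⁻¹) ^ (n + 1) + α * |w.1 - z.1|)
        Filter.atTop (𝓝 (2 * 0 + α * |w.1 - z.1|)) :=
      (((tendsto_pow_atTop_nhds_zero_of_lt_one (inv_nonneg.2 (by linarith))
        (inv_lt_one_of_one_lt₀ hK₀)).comp (Filter.tendsto_add_atTop_nat 1)).const_mul 2).add_const _
    rw [mul_zero, zero_add] at hK
    refine ge_of_tendsto' hK fun n => ?_
    obtain ⟨Γ, hs, hΓ⟩ := exists_coneGraph_subset_strip hα₀ hα₁ hK₀ hH (n + 1) ω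
    have close : ∀ p ∈ M.unstableManifold ω, ∃ p' ∈ Γ, p'.1 = p.1 ∧
        |p'.2 - p.2| ≤ K₀⁻¹ ^ (n + 1) := fun p hp => by
      have hpn : p ∈ M.strip (n + 1) ω := mem_iInter.1 hp n
      obtain ⟨p', hp', e⟩ := hΓ.exists_fst_eq p.1 (strip_subset_unitSquare _ _ hpn).1
      refine ⟨p', hp', e, ?_⟩
      have := strip_thickness hα₀ hα₁ hK₀ hH (n + 1) ω hpn (hs hp')
        (by rw [e, sub_self, abs_zero]; positivity)
      rw [inv_pow, ← one_div, le_div_iff₀ (by positivity)]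
      linarith
    obtain ⟨z', hz', ez, hz2⟩ := close z hz
    obtain ⟨w', hw', ew, hw2⟩ := close w hw
    have h1 := hΓ.cone z' hz' w' hw'
    rw [ez, ew] at h1
    rw [abs_le] at h1 hz2 hw2 ⊢
    constructor <;> linarith
  -- Nested compact vertical slices, each met by a cone graph inside the strip.
  · have hne : (⋂ n : ℕ, M.strip (n + 1) ω ∩ {z | z.1 = x}).Nonempty := by
      refine IsCompact.nonempty_iInter_of_sequence_nonempty_isCompact_isClosed _
        (fun n => inter_subset_inter_left _ (strip_succ_subset_strip _ _)) (fun n => ?_)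
        ((isCompact_strip _ _).inter_right (isClosed_eq continuous_fst continuous_const))
        fun n => (isCompact_strip _ _).isClosed.inter
          (isClosed_eq continuous_fst continuous_const)
      obtain ⟨Γ, hs, hΓ⟩ := exists_coneGraph_subset_strip hα₀ hα₁ hK₀ hH (n + 1) ω
      obtain ⟨z, hz, e⟩ := hΓ.exists_fst_eq x hx
      exact ⟨z, hs hz, e⟩
    obtain ⟨z, hz⟩ := hne
    rw [mem_iInter] at hz
    exact ⟨z, mem_iInter.2 fun n => (hz n).1, (hz 0).2⟩

/-- The piece of an unstable manifold in `E i` is mapped onto a full unstable manifold. -/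
theorem image_fst_unstableManifold (hα₀ : 0 < α) (hα₁ : α < 1) (hK₀ : 1 < K₀)
    (hH : M.HyperbolicityConditions α K₀) (i : ι) (ω : ℕ → ι) :
    (fun z => (M.f i z).1) '' (M.unstableManifold ω ∩ (M.E i).toSet) = Icc 0 1 := by
  have hm := M.mapsOnto i
  apply Subset.antisymm
  · rintro _ ⟨z, hz, rfl⟩
    exact (hm.map_mem hz.2).1
  intro t ht
  -- The past here is `ω` with `i` prepended. Its strip of depth `n + 2` is the image of the depth
  -- `n + 1` strip of `ω` cut by `E i`; injectivity makes the preimages of `q` agree at all depths.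
  obtain ⟨q, hq, rfl⟩ := (isConeGraph_unstableManifold hα₀ hα₁ hK₀ hH
    (fun n => Nat.casesOn n i ω)).exists_fst_eq t ht
  have hq' := mem_iInter.1 hq
  obtain ⟨p, hp, rfl⟩ := hq' 0
  refine ⟨p, ⟨mem_iInter.2 fun n => ?_, hp.2⟩, rfl⟩
  obtain ⟨p', hp', e⟩ := hq' (n + 1)
  rw [← hm.injOn hp'.2 hp.2 e]
  exact hp'.1

end Model

/-! ### Distortion of the horizontal expansion -/

namespace Model

variable {ι : Type*} {M : Model ι} {α K₀ C₀ : ℝ}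

theorem abs_partialX_bounds (hα₀ : 0 < α) (hK₀ : 1 < K₀)
    (hH : M.HyperbolicityConditions α K₀) (i : ι) {z : ℝ × ℝ} (hz : z ∈ (M.E i).toSet) :
    1 < |(partialX (M.f i) z).1| ∧ |(partialX (M.f i) z).2| ≤ α * |(partialX (M.f i) z).1| ∧
      |(partialY (M.f i) z).1| ≤ α * |(partialX (M.f i) z).1| := by
  have h1 := hH.cone_u i z hz
  have h2 := hH.expansion_u i z hz
  have h3 := hH.cone_s i z hz
  have p1 := mul_nonneg hα₀.le (abs_nonneg (partialY (M.f i) z).1)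
  have p2 := mul_nonneg hα₀.le (abs_nonneg (partialY (M.f i) z).2)
  have p3 := mul_nonneg (sq_nonneg α) (abs_nonneg (partialY (M.f i) z).1)
  have p4 := mul_nonneg (sq_nonneg α) (abs_nonneg (partialX (M.f i) z).2)
  refine ⟨?_, ?_, ?_⟩ <;> linarith

/-- The logarithm of the horizontal expansion along a curve. -/
theorem exists_hasDerivAt_log_partialX (hα₀ : 0 < α) (hα₁ : α < 1) (hK₀ : 1 < K₀)
    (hH : M.HyperbolicityConditions α K₀) (hD : M.DistortionCondition C₀) (i : ι)
    {γ : ℝ → ℝ × ℝ} {v : ℝ × ℝ} {t : ℝ} (hγ : γ t ∈ (M.E i).toSet) (hd : HasDerivAt γ v t) :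
    ∃ d, HasDerivAt (fun s => Real.log (partialX (M.f i) (γ s)).1) d t ∧
      |d| ≤ C₀ * (|v.1| + |v.2|) := by
  obtain ⟨b1, b2, -⟩ := abs_partialX_bounds hα₀ hK₀ hH i hγ
  have hC := hD i _ hγ
  set P := partialX (M.f i) with hP
  -- Since `|F₂ₓ| ≤ α|F₁ₓ|`, the distortion condition is in effect relative to `|F₁ₓ|`.
  have hnorm : ‖P (γ t)‖ = |(P (γ t)).1| := by
    rw [Prod.norm_def, Real.norm_eq_abs, Real.norm_eq_abs, max_eq_left]
    nlinarith
  have hpos : 0 < |(P (γ t)).1| := by linarith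
  rw [hnorm, div_lt_iff₀ hpos] at hC
  have hdiff : DifferentiableAt ℝ P (γ t) :=
    ((((M.mapsOnto i).contDiffAt hγ).fderiv_right (m := 1) (by norm_num)).differentiableAt
      (by norm_num)).clm_apply (differentiableAt_const _)
  have h1 := hasDerivAt_fst (hdiff.hasFDerivAt.comp_hasDerivAt t hd)
  refine ⟨_, h1.log (abs_pos.1 hpos), ?_⟩
  rw [Function.comp_apply, abs_div, div_le_iff₀ hpos, fderiv_apply_eq_partial]
  have k1 : |(partialX P (γ t)).1| ≤ secondDerivSize (M.f i) (γ t) :=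
    (norm_fst_le (partialX P (γ t))).trans (le_max_left _ _)
  have k2 : |(partialY P (γ t)).1| ≤ secondDerivSize (M.f i) (γ t) :=
    (norm_fst_le (partialY P (γ t))).trans ((le_max_left _ _).trans (le_max_right _ _))
  rw [Prod.fst_add, Prod.smul_fst, Prod.smul_fst, smul_eq_mul, smul_eq_mul]
  refine (abs_add_le _ _).trans ?_
  rw [abs_mul, abs_mul]
  have k3 := mul_le_mul_of_nonneg_left (k1.trans hC.le) (abs_nonneg v.1)
  have k4 := mul_le_mul_of_nonneg_left (k2.trans hC.le) (abs_nonneg v.2)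
  nlinarith

theorem log_partialX_horizontal (hα₀ : 0 < α) (hα₁ : α < 1) (hK₀ : 1 < K₀) (hC₀ : 0 < C₀)
    (hH : M.HyperbolicityConditions α K₀) (hD : M.DistortionCondition C₀) (i : ι)
    {z w : ℝ × ℝ} (hz : z ∈ (M.E i).toSet) (hw : w ∈ (M.E i).toSet) (h : z.2 = w.2) :
    |Real.log (partialX (M.f i) w).1 - Real.log (partialX (M.f i) z).1| ≤ C₀ := by
  have hd : ∀ t ∈ Icc (0 : ℝ) 1, _ := fun t ht => exists_hasDerivAt_log_partialX hα₀ hα₁ hK₀ hH hD i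
    (γ := fun s => z + s • (w - z)) (segment_horizontal_subset _ hz hw h t ht)
    (hasDerivAt_segment z w t)
  choose! d hd hb using hd
  obtain ⟨t, ht, e⟩ := exists_abs_sub_eq_abs_deriv hd
  have h1 := hb t ht
  rw [← e, Prod.snd_sub, h, sub_self, abs_zero, add_zero] at h1
  have h2 : |(w - z).1| ≤ 1 := by
    obtain ⟨⟨a1, a2⟩, -⟩ := (M.E i).toSet_subset_unitSquare hz
    obtain ⟨⟨a3, a4⟩, -⟩ := (M.E i).toSet_subset_unitSquare hw
    rw [Prod.fst_sub, abs_le]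
    constructor <;> linarith
  simp only [one_smul, zero_smul, add_zero, add_sub_cancel] at h1
  nlinarith

/-- The side itself is only Lipschitz, so the two points are joined by the smooth preimage of a
vertical segment. That curve lies in the stable cone, where `|γ₁'| + |γ₂'| ≤ 2|γ₂'|`, and Cauchy's
mean value theorem compares the variation with the height difference, at most `1`. -/
theorem log_partialX_left (hα₀ : 0 < α) (hα₁ : α < 1) (hK₀ : 1 < K₀) (hC₀ : 0 < C₀)
    (hH : M.HyperbolicityConditions α K₀) (hD : M.DistortionCondition C₀) (i : ι)
    {y y' : ℝ} (hy : y ∈ Icc (0 : ℝ) 1) (hy' : y' ∈ Icc (0 : ℝ) 1) :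
    |Real.log (partialX (M.f i) ((M.E i).left y', y')).1 -
      Real.log (partialX (M.f i) ((M.E i).left y, y)).1| ≤ 2 * C₀ := by
  by_cases hne : y = y'
  · rw [hne, sub_self, abs_zero]; positivity
  obtain ⟨a, _, _, hl, -⟩ := exists_fst_lateral (M := M) i
  have hp := (M.E i).left_mem hy
  have hq := (M.E i).left_mem hy'
  obtain ⟨hseg, hc⟩ := vertical_pair i hp hq ((hl y hy).trans (hl y' hy').symm) hα₀
  obtain ⟨γ, γ', e0, e1, hγ⟩ := exists_preimage_curve hα₀ hα₁ hK₀ hH i hp hq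
    (fun h => hne (congrArg Prod.snd h)) hseg hc
  have hd : ∀ t ∈ Icc (0 : ℝ) 1, _ := fun t ht => exists_hasDerivAt_log_partialX hα₀ hα₁ hK₀ hH hD i
    (hγ t ht).1 (hγ t ht).2.1
  choose! d hd hb using hd
  have := abs_sub_le_of_abs_deriv_le (C := 2 * C₀) hd
    (fun t ht => hasDerivAt_snd (hγ t ht).2.1) (fun t ht => (hγ t ht).2.2.2.2) fun t ht => by
      have h1 := hb t ht
      have h2 := (hγ t ht).2.2.1
      have h3 := abs_nonneg (γ' t).2
      have h4 : |(γ' t).1| ≤ |(γ' t).2| := by nlinarith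
      nlinarith
  rw [e0, e1] at this
  have h2 : |y' - y| ≤ 1 := by
    rw [abs_le]
    constructor <;> linarith [hy.1, hy.2, hy'.1, hy'.2]
  nlinarith

/-- Bounded distortion of the horizontal expansion over the whole rectangle `E i`. -/
theorem abs_partialX_le (hα₀ : 0 < α) (hα₁ : α < 1) (hK₀ : 1 < K₀) (hC₀ : 0 < C₀)
    (hH : M.HyperbolicityConditions α K₀) (hD : M.DistortionCondition C₀) (i : ι)
    {z w : ℝ × ℝ} (hz : z ∈ (M.E i).toSet) (hw : w ∈ (M.E i).toSet) :
    |(partialX (M.f i) w).1| ≤ Real.exp (4 * C₀) * |(partialX (M.f i) z).1| := by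
  have h1 := log_partialX_horizontal hα₀ hα₁ hK₀ hC₀ hH hD i hz ((M.E i).left_mem hz.1) rfl
  have h2 := log_partialX_left hα₀ hα₁ hK₀ hC₀ hH hD i hz.1 hw.1
  have h3 := log_partialX_horizontal hα₀ hα₁ hK₀ hC₀ hH hD i ((M.E i).left_mem hw.1) hw rfl
  have pz : 0 < |(partialX (M.f i) z).1| :=
    zero_lt_one.trans (abs_partialX_bounds hα₀ hK₀ hH i hz).1
  have pw : 0 < |(partialX (M.f i) w).1| :=
    zero_lt_one.trans (abs_partialX_bounds hα₀ hK₀ hH i hw).1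
  rw [abs_le] at h1 h2 h3
  rw [← Real.exp_log pw, ← Real.exp_log pz, ← Real.exp_add, Real.exp_le_exp, Real.log_abs,
    Real.log_abs]
  linarith

/-! ### Length estimate and conclusion -/

/-- The length of the piece of an unstable manifold in `E i` is comparable to the inverse of the
horizontal expansion at any point of `E i`. -/
theorem curveLength_bounds (hα₀ : 0 < α) (hα₁ : α < 1) (hK₀ : 1 < K₀) (hC₀ : 0 < C₀)
    (hH : M.HyperbolicityConditions α K₀) (hD : M.DistortionCondition C₀) (i : ι) (ω : ℕ → ι)
    {p : ℝ × ℝ} (hp : p ∈ (M.E i).toSet) :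
    (2 * Real.exp (4 * C₀) * |(partialX (M.f i) p).1|)⁻¹ ≤
        curveLength (M.unstableManifold ω ∩ (M.E i).toSet) ∧
      curveLength (M.unstableManifold ω ∩ (M.E i).toSet) ≤
        ((1 - α ^ 2) / Real.exp (4 * C₀) * |(partialX (M.f i) p).1|)⁻¹ := by
  have hG := isConeGraph_unstableManifold hα₀ hα₁ hK₀ hH ω
  have hpos : 0 < |(partialX (M.f i) p).1| :=
    zero_lt_one.trans (abs_partialX_bounds hα₀ hK₀ hH i hp).1
  have hα2 : 0 < 1 - α ^ 2 := by nlinarith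
  have hexp := Real.exp_pos (4 * C₀)
  have key : ∀ z ∈ M.unstableManifold ω ∩ (M.E i).toSet,
      ∀ w ∈ M.unstableManifold ω ∩ (M.E i).toSet, dist z w = |w.1 - z.1| ∧
      ∃ q ∈ (M.E i).toSet,
        (1 - α ^ 2) * |(partialX (M.f i) q).1| * |w.1 - z.1| ≤ |(M.f i z).1 - (M.f i w).1| ∧
        |(M.f i z).1 - (M.f i w).1| ≤ 2 * |(partialX (M.f i) q).1| * |w.1 - z.1| := by
    intro z hz w hw
    have h := hG.cone z hz.1 w hw.1
    constructor
    · rw [dist_comm, Prod.dist_eq, Real.dist_eq, Real.dist_eq, max_eq_left]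
      nlinarith [abs_nonneg (w.1 - z.1)]
    obtain ⟨-, q, hq, e⟩ := image_cone hα₀ hK₀ hH i
      (segment_subset_E hα₀ hα₁ hK₀ hH i hz.2 hw.2 h) h
    refine ⟨q, hq, ?_⟩
    obtain ⟨b1, -, b2⟩ := abs_partialX_bounds hα₀ hK₀ hH i hq
    rw [abs_sub_comm (M.f i z).1, e]
    have u := abs_add_le ((w.1 - z.1) * (partialX (M.f i) q).1)
      ((w.2 - z.2) * (partialY (M.f i) q).1)
    have l := abs_sub_abs_le_abs_sub ((w.1 - z.1) * (partialX (M.f i) q).1)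
      (-((w.2 - z.2) * (partialY (M.f i) q).1))
    rw [abs_neg, sub_neg_eq_add] at l
    rw [abs_mul, abs_mul] at u l
    -- The slope of the graph and `|F₁ᵧ| ≤ α|F₁ₓ|` each contribute a factor `α`, so the stretching
    -- lies between `1 - α²` and `1 + α² ≤ 2` times `|F₁ₓ|`.
    have m := mul_le_mul h b2 (abs_nonneg _) (by positivity)
    have n := mul_nonneg (abs_nonneg (w.1 - z.1)) (abs_nonneg (partialX (M.f i) q).1)
    constructor <;> nlinarith
  refine hausdorffMeasure_bounds (image_fst_unstableManifold hα₀ hα₁ hK₀ hH i ω)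
    (by positivity) (by positivity) (fun z hz w hw => ?_) fun z hz w hw => ?_
  · obtain ⟨e, q, hq, h1, -⟩ := key z hz w hw
    rw [e]
    refine le_trans (mul_le_mul_of_nonneg_right ?_ (abs_nonneg _)) h1
    rw [div_mul_eq_mul_div, mul_div_assoc]
    refine mul_le_mul_of_nonneg_left ?_ hα2.le
    rw [div_le_iff₀' hexp]
    exact abs_partialX_le hα₀ hα₁ hK₀ hC₀ hH hD i hq hp
  · obtain ⟨e, q, hq, -, h2⟩ := key z hz w hw
    rw [e]
    refine h2.trans (mul_le_mul_of_nonneg_right ?_ (abs_nonneg _))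
    rw [mul_assoc]
    exact mul_le_mul_of_nonneg_left (abs_partialX_le hα₀ hα₁ hK₀ hC₀ hH hD i hp hq) zero_le_two

end Model

end CountableMarkov

theorem corollary5p8 {ι : Type*} [Countable ι] (M : CountableMarkov.Model ι)
    (hG : M.GeometricConditions)
    (α K₀ C₀ : ℝ) (hα₀ : 0 < α) (hα₁ : α < 1) (hK₀ : 1 < K₀) (hC₀ : 0 < C₀)
    (hH : M.HyperbolicityConditions α K₀) (hD : M.DistortionCondition C₀) :
    ∃ c : ℝ, ∀ i : ι, ∀ z₁ ∈ (M.E i).toSet ∩ M.attractor, ∀ z₂ ∈ (M.E i).toSet ∩ M.attractor,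
      ∀ W₁ W₂ : Set (ℝ × ℝ), M.IsUnstableManifoldAt z₁ W₁ → M.IsUnstableManifoldAt z₂ W₂ →
        0 < CountableMarkov.curveLength (W₁ ∩ (M.E i).toSet) ∧
        0 < CountableMarkov.curveLength (W₂ ∩ (M.E i).toSet) ∧
        CountableMarkov.curveLength (W₁ ∩ (M.E i).toSet) /
          CountableMarkov.curveLength (W₂ ∩ (M.E i).toSet) < c := by
  have hα2 : 0 < 1 - α ^ 2 := by nlinarith
  set D := Real.exp (4 * C₀) with hDdef
  have hDpos : 0 < D := Real.exp_pos _
  -- The quotient of the upper and lower length bounds; adding `1` makes the inequality strict.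
  refine ⟨2 * D ^ 2 / (1 - α ^ 2) + 1, ?_⟩
  rintro i z₁ ⟨hz₁, -⟩ z₂ - W₁ W₂ ⟨-, ω₁, rfl⟩ ⟨-, ω₂, rfl⟩
  -- Both pieces are measured against the expansion at the same point `z₁`, which then cancels.
  obtain ⟨a₁, b₁⟩ := CountableMarkov.Model.curveLength_bounds hα₀ hα₁ hK₀ hC₀ hH hD i ω₁ hz₁
  obtain ⟨a₂, -⟩ := CountableMarkov.Model.curveLength_bounds hα₀ hα₁ hK₀ hC₀ hH hD i ω₂ hz₁
  have hm : 0 < |(CountableMarkov.partialX (M.f i) z₁).1| :=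
    zero_lt_one.trans (CountableMarkov.Model.abs_partialX_bounds hα₀ hK₀ hH i hz₁).1
  rw [← hDdef] at a₁ b₁ a₂
  have hpos : 0 < (2 * D * |(CountableMarkov.partialX (M.f i) z₁).1|)⁻¹ := by positivity
  refine ⟨hpos.trans_le a₁, hpos.trans_le a₂, ?_⟩
  refine lt_of_le_of_lt (div_le_div₀ (by positivity) b₁ hpos a₂) ?_
  refine lt_of_eq_of_lt ?_ (lt_add_one _)
  field_simp
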